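/- Consider four machines $m_1,m_2,m_3,m_4$ with conflict graph $K_3+e$: $m_1,m_2,m_3$ are pairwise in conflict, and $m_4$ is in conflict with $m_3$ only. An input (in the original, block-arrival model) is a finite list of jobs $(t,k,s)$, meaning that a block of load $s\ge 0$ arrives at time $t\ge 0$ in the buffer of machine $m_k$; all buffers are empty before time $0$. A schedule assigns to each machine at each time a nonnegative speed (measurable in time) such that at each time the speeds of any set of pairwise conflicting machines add up to at most $1$; a machine processes load at its speed as long as its load is positive. Let $a_i^t$ be the load on $m_i$ at time $t$, including jobs arriving at time $t$. For an input $I$, let $\mathrm{Opt}(I)$ be the infimum, over all schedules chosen with knowledge of the whole input, of the maximal load on a machine over time. The online algorithm PrioGreedy$_{\text{original}}$ acts at each time according to the current loads as follows. If $a_3>5/4$, run $m_3$ (at speed $1$). Otherwise, if $a_4>5/4$ or $a_1+a_2>1$ or $a_3=0$, run $m_4$ (at speed $1$) and run Greedy on $m_1$ and $m_2$, i.e. run at speed $1$ the one of $m_1,m_2$ that has the higher load, and run both at speed $1/2$ if their loads are equal. Otherwise, run $m_3$ (at speed $1$). Theorem. PrioGreedy$_{\text{original}}$ is $9/4$-competitive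 on $K_3+e$ (with respect to the weak competitive ratio, where the offline optimum is normalized to $1$): for every input $I$ with $\mathrm{Opt}(I)=1$, the algorithm has a well-defined run, and in every run of the algorithm on $I$ one has $a_i^t\le \frac94\,\mathrm{Opt}(I)=\frac94$ for all $t\ge 0$ and $i\in\{1,2,3,4\}$. -/

import Mathlib

namespace BufferMin

/-- A job: at time `time`, a block of load `size` arrives on `machine`. -/
structure Job (V : Type*) where
  time : ℝ
  machine : V
  size : ℝ
  time_nonneg : 0 ≤ time
  size_nonneg : 0 ≤ size

/-- An input of the original (block-arrival) model: a finite list of jobs. -/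
abbrev Input (V : Type*) := List (Job V)

/-- The total load that has arrived on machine `i` up to and including time `t`. -/
noncomputable def arrived {V : Type*} [DecidableEq V] (I : Input V) (i : V) (t : ℝ) : ℝ :=
  (I.map fun j => if j.machine = i ∧ j.time ≤ t then j.size else 0).sum

/-- A schedule for the conflict graph `G`: each machine has a nonnegative speed at each time,
and the speeds of pairwise conflicting machines add up to at most `1` (in particular each single
speed is at most `1`). Running an independent set of machines at full speed is the special case
of speeds `0` and `1`. -/
structure Schedule {V : Type*} (G : SimpleGraph V) where
  speed : ℝ → V → ℝ
  measurable_speed : ∀ i, Measurable fun t => speed t i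
  speed_nonneg : ∀ t i, 0 ≤ speed t i
  clique_le_one : ∀ t, ∀ K : Finset V, G.IsClique (K : Set V) → ∑ i ∈ K, speed t i ≤ 1

/-- `a t i` is the load on machine `i` at time `t ≥ 0` (including the jobs that arrive at time `t`)
when the input `I` is processed by the schedule `σ` from empty buffers: the load is what has
arrived minus what has been processed, and a machine processes load only while it has some. -/
structure IsLoad {V : Type*} [DecidableEq V] {G : SimpleGraph V} (I : Input V) (σ : Schedule G)
    (a : ℝ → V → ℝ) : Prop where
  measurable_load : ∀ i, Measurable fun t => a t i
  load_nonneg : ∀ t, 0 ≤ t → ∀ i, 0 ≤ a t i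
  balance : ∀ t, 0 ≤ t → ∀ i,
    a t i = arrived I i t - ∫ s in (0 : ℝ)..t, (if 0 < a s i then σ.speed s i else 0)

/-- The offline optimum: the infimum of the buffer sizes `B` for which some schedule (chosen with
full knowledge of the input) keeps every load at most `B` at all times. -/
noncomputable def optBuffer {V : Type*} [DecidableEq V] (G : SimpleGraph V) (I : Input V) : ℝ :=
  sInf {B : ℝ | ∃ (σ : Schedule G) (z : ℝ → V → ℝ), IsLoad I σ z ∧
    ∀ t, 0 ≤ t → ∀ i, z t i ≤ B}

/-- `a` is a load trajectory of the online algorithm `alg` on the input `I`. The algorithm chooses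
the speeds at each time from the loads at that time, and these speeds form a schedule for `G`. -/
def IsRun {V : Type*} [DecidableEq V] (G : SimpleGraph V) (alg : (V → ℝ) → V → ℝ) (I : Input V)
    (a : ℝ → V → ℝ) : Prop :=
  ∃ σ : Schedule G, (∀ t, 0 ≤ t → σ.speed t = alg (a t)) ∧ IsLoad I σ a

/-- `alg` is `c`-competitive on `G` (weak competitive ratio: the offline optimum is known and
normalized to `1`): on each input with offline optimum `1`, the algorithm has a run, and in every
run all loads are at all times at most `c` times the offline optimum. -/
def IsWeaklyCompetitive {V : Type*} [DecidableEq V] (G : SimpleGraph V)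
    (alg : (V → ℝ) → V → ℝ) (c : ℝ) : Prop :=
  ∀ I : Input V, optBuffer G I = 1 →
    (∃ a, IsRun G alg I a) ∧
    ∀ a, IsRun G alg I a → ∀ t, 0 ≤ t → ∀ i, a t i ≤ c * optBuffer G I

/-- The graph `K₃ + e`. The vertices `0, 1, 2, 3` are the machines `m₁, m₂, m₃, m₄`; the first
three form a triangle and `m₄` is adjacent to `m₃` only. -/
def K3e : SimpleGraph (Fin 4) :=
  SimpleGraph.fromEdgeSet {s(0, 1), s(0, 2), s(1, 2), s(2, 3)}

/-- The speed that Greedy, run on two conflicting machines, gives to a machine with load `x` when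
the other one has load `y`: the machine with the higher load runs, and machines with equal loads
run at equal speeds. -/
noncomputable def greedySpeed (x y : ℝ) : ℝ :=
  if y < x then 1 else if x = y then 1 / 2 else 0

/-- The algorithm PrioGreedy for the original model on `K₃ + e`: the speeds of `m₁, m₂, m₃, m₄` as
a function of the current loads. -/
noncomputable def prioGreedyOriginal (a : Fin 4 → ℝ) : Fin 4 → ℝ :=
  if a 2 > 5 / 4 then ![0, 0, 1, 0]
  else if a 3 > 5 / 4 ∨ a 0 + a 1 > 1 ∨ a 2 = 0 then
    ![greedySpeed (a 0) (a 1), greedySpeed (a 1) (a 0), 0, 1]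
  else ![0, 0, 1, 0]

end BufferMin

namespace BufferMin

open MeasureTheory

/-! Machines are indexed 0 to 3. Compare a run `a` with a schedule whose loads `z` stay below some
`B` close to 1. In `u = a - z` the arrivals cancel, so `u` is the integral of the schedule's rate
minus the algorithm's rate. By `primitive_le`, a sum of components of `u` stays below `c` if,
whenever it exceeds `c`, the algorithm works on those machines at least as fast as the schedule.
Conflicts limit the schedule to total rate 1 on {2, 3} and on any part of {0, 1, 2}, so it suffices
that the algorithm reaches rate 1 there.

This bounds u₂ + u₃, u₂ and u₃ by 5/4, u₀ + u₁ + u₂ and u₀ + u₁ by B, and, for i = 0, 1, uᵢ + u₂ by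
2B - 1/2 and uᵢ by 3B - 7/4, the later bounds resting on earlier ones. Adding zᵢ ≤ B gives 4B - 7/4
(`load_le_of_schedule`), which tends to 9/4 as B tends to 1.

The speeds are discontinuous in the loads, so a run is built explicitly. The rates depend only on
which of nine affine functionals are positive. Without arrivals none of them becomes positive, so
finitely many phases of constant rates suffice (`exists_linear_phase`, `exists_solvesOn_const`).
Jobs are then added in order of time. -/

/-- The rates at which the algorithm removes load, as a function of the current loads. -/
noncomputable def processingRate (x : Fin 4 → ℝ) (i : Fin 4) : ℝ :=
  if 0 < x i then prioGreedyOriginal x i else 0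

/-! ### Speeds and work conservation of the algorithm -/

section Speeds

lemma greedySpeed_nonneg (x y : ℝ) : 0 ≤ greedySpeed x y := by
  unfold greedySpeed; split_ifs <;> norm_num

lemma greedySpeed_le_one (x y : ℝ) : greedySpeed x y ≤ 1 := by
  unfold greedySpeed; split_ifs <;> norm_num

lemma greedySpeed_add_swap (x y : ℝ) : greedySpeed x y + greedySpeed y x = 1 := by
  unfold greedySpeed
  rcases lt_trichotomy x y with h | h | h
  · simp [h, h.not_gt, h.ne]
  · simp [h]; norm_num
  · simp [h, h.not_gt, h.ne]

lemma greedySpeed_of_lt {x y : ℝ} (h : y < x) : greedySpeed x y = 1 := by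
  simp [greedySpeed, h]

lemma prioGreedyOriginal_nonneg (x : Fin 4 → ℝ) (i : Fin 4) : 0 ≤ prioGreedyOriginal x i := by
  unfold prioGreedyOriginal
  split_ifs <;> fin_cases i <;> simp [greedySpeed_nonneg]

lemma prioGreedyOriginal_le_one (x : Fin 4 → ℝ) (i : Fin 4) : prioGreedyOriginal x i ≤ 1 := by
  unfold prioGreedyOriginal
  split_ifs <;> fin_cases i <;> simp [greedySpeed_le_one]

lemma measurable_prioGreedyOriginal (i : Fin 4) :
    Measurable fun x : Fin 4 → ℝ => prioGreedyOriginal x i := by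
  have m : ∀ k : Fin 4, Measurable fun x : Fin 4 → ℝ => x k := fun k => measurable_pi_apply k
  have hg : ∀ k l : Fin 4, Measurable fun x : Fin 4 → ℝ => greedySpeed (x k) (x l) := fun k l =>
    Measurable.ite (measurableSet_lt (m l) (m k)) measurable_const
      (Measurable.ite (measurableSet_eq_fun (m k) (m l)) measurable_const measurable_const)
  have h1 : MeasurableSet {x : Fin 4 → ℝ | x 2 > 5 / 4} := measurableSet_lt measurable_const (m 2)
  have h2 : MeasurableSet {x : Fin 4 → ℝ | x 3 > 5 / 4 ∨ x 0 + x 1 > 1 ∨ x 2 = 0} :=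
    (measurableSet_lt measurable_const (m 3)).union
      ((measurableSet_lt measurable_const ((m 0).add (m 1))).union
        (measurableSet_eq_fun (m 2) measurable_const))
  have key : ∀ f : (Fin 4 → ℝ) → ℝ, Measurable f → ∀ c : ℝ, Measurable fun x : Fin 4 → ℝ =>
      if x 2 > 5 / 4 then c
      else if x 3 > 5 / 4 ∨ x 0 + x 1 > 1 ∨ x 2 = 0 then f x else c := fun f hf c =>
    Measurable.ite h1 measurable_const (Measurable.ite h2 hf measurable_const)
  have e : (fun x : Fin 4 → ℝ => prioGreedyOriginal x i) = fun x =>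
      if x 2 > 5 / 4 then (![0, 0, 1, 0] : Fin 4 → ℝ) i
      else if x 3 > 5 / 4 ∨ x 0 + x 1 > 1 ∨ x 2 = 0 then
        (![greedySpeed (x 0) (x 1), greedySpeed (x 1) (x 0), 0, 1] : Fin 4 → ℝ) i
      else (![0, 0, 1, 0] : Fin 4 → ℝ) i := by
    funext x
    unfold prioGreedyOriginal
    split_ifs <;> rfl
  rw [e]
  refine key _ ?_ _
  fin_cases i
  · exact hg 0 1
  · exact hg 1 0
  · exact measurable_const
  · exact measurable_const

lemma sum_prioGreedyOriginal_le_one (x : Fin 4 → ℝ) (K : Finset (Fin 4))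
    (hK : K3e.IsClique (K : Set (Fin 4))) : ∑ i ∈ K, prioGreedyOriginal x i ≤ 1 := by
  have mono : ∀ L : Finset (Fin 4), K ⊆ L →
      ∑ i ∈ K, prioGreedyOriginal x i ≤ ∑ i ∈ L, prioGreedyOriginal x i := fun L hL =>
    Finset.sum_le_sum_of_subset_of_nonneg hL fun i _ _ => prioGreedyOriginal_nonneg x i
  by_cases h3 : (3 : Fin 4) ∈ K
  · have hsub : K ⊆ {2, 3} := by
      intro k hk
      by_contra hk'
      have hne : k ≠ 3 := by rintro rfl; simp at hk'
      have := hK (Finset.mem_coe.2 hk) (Finset.mem_coe.2 h3) hne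
      revert this hk'
      fin_cases k <;> simp [K3e]
    refine (mono _ hsub).trans ?_
    rw [Finset.sum_pair (by decide)]
    unfold prioGreedyOriginal
    split_ifs <;> simp
  · have hsub : K ⊆ {0, 1, 2} := by
      intro k hk
      have hne : k ≠ 3 := by rintro rfl; exact h3 hk
      revert hne
      fin_cases k <;> simp
    refine (mono _ hsub).trans ?_
    rw [Finset.sum_insert (by decide), Finset.sum_pair (by decide)]
    unfold prioGreedyOriginal
    split_ifs <;> simp [greedySpeed_add_swap]

lemma processingRate_nonneg (x : Fin 4 → ℝ) (i : Fin 4) : 0 ≤ processingRate x i := by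
  unfold processingRate
  split_ifs
  exacts [prioGreedyOriginal_nonneg x i, le_rfl]

lemma processingRate_le_one (x : Fin 4 → ℝ) (i : Fin 4) : processingRate x i ≤ 1 := by
  unfold processingRate
  split_ifs
  exacts [prioGreedyOriginal_le_one x i, zero_le_one]

lemma measurable_processingRate (i : Fin 4) :
    Measurable fun x : Fin 4 → ℝ => processingRate x i :=
  Measurable.ite (measurableSet_lt measurable_const (measurable_pi_apply i))
    (measurable_prioGreedyOriginal i) measurable_const

variable {x : Fin 4 → ℝ}

lemma prioGreedyOriginal_cases (x : Fin 4 → ℝ) :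
    (prioGreedyOriginal x = ![0, 0, 1, 0] ∧ x 2 ≠ 0 ∧
      (5 / 4 < x 2 ∨ x 3 ≤ 5 / 4 ∧ x 0 + x 1 ≤ 1)) ∨
    (prioGreedyOriginal x = ![greedySpeed (x 0) (x 1), greedySpeed (x 1) (x 0), 0, 1] ∧
      x 2 ≤ 5 / 4 ∧ (5 / 4 < x 3 ∨ 1 < x 0 + x 1 ∨ x 2 = 0)) := by
  unfold prioGreedyOriginal
  split_ifs with h1 h2
  · exact Or.inl ⟨rfl, by linarith, Or.inl h1⟩
  · exact Or.inr ⟨rfl, not_lt.1 h1, h2⟩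
  · push Not at h2
    exact Or.inl ⟨rfl, h2.2.2, Or.inr ⟨h2.1, h2.2.1⟩⟩

/-- Greedy wastes no capacity as long as one of its machines is loaded. -/
lemma greedy_work (h0 : 0 ≤ x 0) (h1 : 0 ≤ x 1) (h : ¬ (x 0 = 0 ∧ x 1 = 0)) :
    (if 0 < x 0 then greedySpeed (x 0) (x 1) else 0) +
      (if 0 < x 1 then greedySpeed (x 1) (x 0) else 0) = 1 := by
  rcases h0.eq_or_lt with e0 | p0 <;> rcases h1.eq_or_lt with e1 | p1
  · exact absurd ⟨e0.symm, e1.symm⟩ h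
  · rw [if_neg (by rw [← e0]; exact lt_irrefl _), if_pos p1, greedySpeed_of_lt (by rwa [← e0]),
      zero_add]
  · rw [if_pos p0, if_neg (by rw [← e1]; exact lt_irrefl _), greedySpeed_of_lt (by rwa [← e1]),
      add_zero]
  · rw [if_pos p0, if_pos p1, greedySpeed_add_swap]

/-- Machine 2 runs only when loaded, so capacity on this edge is lost only if machine 3 is chosen
while empty, which requires that machine 2 is not above its priority level. -/
lemma processingRate_two_add_three (hx : ∀ i, 0 ≤ x i) :
    processingRate x 2 + processingRate x 3 = 1 ∨ x 3 = 0 ∧ x 2 ≤ 5 / 4 := by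
  unfold processingRate
  rcases prioGreedyOriginal_cases x with ⟨e, h2, -⟩ | ⟨e, h2, -⟩
  · left
    rw [if_pos ((hx 2).lt_of_ne' h2), e]
    simp
  · rcases (hx 3).eq_or_lt with h3 | h3
    · exact Or.inr ⟨h3.symm, h2⟩
    · left
      rw [if_pos h3, e]
      simp

lemma processingRate_two (h : 5 / 4 < x 2) : processingRate x 2 = 1 := by
  have h0 : 0 < x 2 := by linarith
  rcases prioGreedyOriginal_cases x with ⟨e, -⟩ | ⟨-, h2, -⟩
  · simp [processingRate, h0, e]
  · linarith

lemma processingRate_three (h3 : 5 / 4 < x 3) (h2 : x 2 ≤ 5 / 4) : processingRate x 3 = 1 := by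
  have h0 : 0 < x 3 := by linarith
  rcases prioGreedyOriginal_cases x with ⟨-, -, h | h⟩ | ⟨e, -⟩
  · linarith
  · linarith
  · simp [processingRate, h0, e]

lemma processingRate_triangle (hx : ∀ i, 0 ≤ x i) :
    processingRate x 0 + processingRate x 1 + processingRate x 2 = 1 ∨
      x 0 = 0 ∧ x 1 = 0 ∧ (5 / 4 < x 3 ∨ x 2 = 0) := by
  unfold processingRate
  rcases prioGreedyOriginal_cases x with ⟨e, h2, -⟩ | ⟨e, -, h3⟩
  · left
    rw [if_pos ((hx 2).lt_of_ne' h2), e]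
    simp
  · by_cases h : x 0 = 0 ∧ x 1 = 0
    · refine Or.inr ⟨h.1, h.2, ?_⟩
      rcases h3 with h3 | h3 | h3
      · exact Or.inl h3
      · rw [h.1, h.2] at h3; norm_num at h3
      · exact Or.inr h3
    · left
      rw [e]
      simpa using greedy_work (hx 0) (hx 1) h

lemma processingRate_zero_add_one (hx : ∀ i, 0 ≤ x i) (h : 1 < x 0 + x 1) (h2 : x 2 ≤ 5 / 4) :
    processingRate x 0 + processingRate x 1 = 1 := by
  unfold processingRate
  rcases prioGreedyOriginal_cases x with ⟨-, -, h' | h'⟩ | ⟨e, -⟩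
  · linarith
  · linarith
  · rw [e]
    simpa using greedy_work (hx 0) (hx 1) (by rintro ⟨h0, h1⟩; rw [h0, h1] at h; norm_num at h)

lemma processingRate_of_greater {i j : Fin 4} (hij : i = 0 ∧ j = 1 ∨ i = 1 ∧ j = 0)
    (hx : ∀ i, 0 ≤ x i) (hlt : x j < x i)
    (h : 5 / 4 < x 3 ∨ 1 < x 0 + x 1 ∨ x 2 = 0) (h2 : x 2 ≤ 5 / 4) :
    processingRate x i = 1 := by
  have hi : 0 < x i := (hx j).trans_lt hlt
  unfold processingRate
  rw [if_pos hi]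
  rcases prioGreedyOriginal_cases x with ⟨-, h2', h' | h'⟩ | ⟨e, -⟩
  · linarith
  · rcases h with h | h | h
    · linarith
    · linarith
    · exact absurd h h2'
  · rw [e]
    rcases hij with ⟨rfl, rfl⟩ | ⟨rfl, rfl⟩ <;> simpa using greedySpeed_of_lt hlt

/-- If machine 2 idles, Greedy gives `i` the full unit as soon as `i` leads; the pair can lose
capacity only while `i` does not lead `j`. -/
lemma processingRate_add_two {i j : Fin 4} (hij : i = 0 ∧ j = 1 ∨ i = 1 ∧ j = 0)
    (hx : ∀ i, 0 ≤ x i) :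
    processingRate x i + processingRate x 2 = 1 ∨
      x i ≤ x j ∧ (5 / 4 < x 3 ∨ 1 < x 0 + x 1 ∨ x 2 = 0) := by
  rcases prioGreedyOriginal_cases x with ⟨e, h2, -⟩ | ⟨e, h2, h3⟩
  · left
    unfold processingRate
    rw [if_pos ((hx 2).lt_of_ne' h2), e]
    rcases hij with ⟨rfl, rfl⟩ | ⟨rfl, rfl⟩ <;> simp
  · rcases le_or_gt (x i) (x j) with h | h
    · exact Or.inr ⟨h, h3⟩
    · left
      rw [processingRate_of_greater hij hx h h3 h2]
      simp [processingRate, e]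

end Speeds

/-! ### Comparison with an offline schedule -/

section Invariants

/-- A bounded measurable function is integrable on every interval. -/
lemma intervalIntegrable_of_abs_le {g : ℝ → ℝ} (hg : Measurable g) {C : ℝ} (hC : ∀ s, |g s| ≤ C)
    (a b : ℝ) : IntervalIntegrable g volume a b :=
  (intervalIntegrable_const (c := C)).mono_fun' hg.aestronglyMeasurable
    (Filter.Eventually.of_forall hC)

/-- A primitive that does not grow while it exceeds `c` stays below `c`. -/
lemma primitive_le {u g : ℝ → ℝ} {c : ℝ} (hc : 0 ≤ c)
    (hg : ∀ a b, IntervalIntegrable g volume a b)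
    (hu : ∀ t, 0 ≤ t → u t = ∫ s in (0 : ℝ)..t, g s)
    (h : ∀ s, 0 ≤ s → c < u s → g s ≤ 0) : ∀ t, 0 ≤ t → u t ≤ c := by
  intro t ht
  by_contra! hct
  have hcont : Continuous fun t => ∫ s in (0 : ℝ)..t, g s :=
    intervalIntegral.continuous_primitive hg 0
  -- The last time up to `t` with value at most `c`: after it the integrand is nonpositive, so the
  -- value at `t` cannot exceed `c`.
  set S : Set ℝ := Set.Icc 0 t ∩ {s | (∫ r in (0 : ℝ)..s, g r) ≤ c}
  have hS : IsCompact S := isCompact_Icc.inter_right (isClosed_le hcont continuous_const)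
  have h0 : (0 : ℝ) ∈ S := ⟨⟨le_rfl, ht⟩, by simpa using hc⟩
  obtain ⟨s, hsS, hmax⟩ := hS.exists_isGreatest ⟨0, h0⟩
  have hs0 : 0 ≤ s := hsS.1.1
  have hst : s ≤ t := hsS.1.2
  have hle : ∫ r in s..t, g r ≤ ∫ r in s..t, (0 : ℝ) := by
    refine intervalIntegral.integral_mono_on_of_le_Ioo hst (hg s t) intervalIntegrable_const ?_
    intro r hr
    refine h r (hs0.trans hr.1.le) ?_
    by_contra! hcr
    have : r ∈ S := ⟨⟨hs0.trans hr.1.le, hr.2.le⟩, by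
      rw [hu r (hs0.trans hr.1.le)] at hcr; exact hcr⟩
    exact absurd (hmax this) (not_le.2 hr.1)
  have hadd := intervalIntegral.integral_add_adjacent_intervals (hg 0 s) (hg s t)
  have hsc : (∫ r in (0 : ℝ)..s, g r) ≤ c := hsS.2
  rw [hu t ht] at hct
  simp at hle
  linarith

lemma sum_le_of_schedule (σ : Schedule K3e) (t : ℝ) :
    σ.speed t 0 + σ.speed t 1 + σ.speed t 2 ≤ 1 ∧ σ.speed t 2 + σ.speed t 3 ≤ 1 := by
  constructor
  · have := σ.clique_le_one t {0, 1, 2} (by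
      intro i hi j hj hne
      simp only [Finset.coe_insert, Finset.coe_singleton, Set.mem_insert_iff,
        Set.mem_singleton_iff] at hi hj
      rcases hi with rfl | rfl | rfl <;> rcases hj with rfl | rfl | rfl <;> simp [K3e] at hne ⊢)
    rw [Finset.sum_insert (by decide), Finset.sum_pair (by decide)] at this
    linarith
  · have := σ.clique_le_one t {2, 3} (by
      intro i hi j hj hne
      simp only [Finset.coe_insert, Finset.coe_singleton, Set.mem_insert_iff,
        Set.mem_singleton_iff] at hi hj
      rcases hi with rfl | rfl <;> rcases hj with rfl | rfl <;> simp [K3e] at hne ⊢)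
    rwa [Finset.sum_pair (by decide)] at this

variable {I : Input (Fin 4)} {σ : Schedule K3e} {a z : ℝ → Fin 4 → ℝ} {B : ℝ}

/-- Against a schedule whose loads stay below `B`, a run of the algorithm keeps every load below
`4 * B - 7 / 4`. -/
lemma load_le_of_schedule (ha : IsRun K3e prioGreedyOriginal I a) (hz : IsLoad I σ z)
    (hzB : ∀ t, 0 ≤ t → ∀ i, z t i ≤ B) (hB1 : 1 ≤ B) (hB2 : B ≤ 5 / 4) :
    ∀ t, 0 ≤ t → ∀ i, a t i ≤ 4 * B - 7 / 4 := by
  obtain ⟨τ, hτ, hl⟩ := ha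
  set r : ℝ → Fin 4 → ℝ := fun s i => if 0 < z s i then σ.speed s i else 0 with hr
  set g : Fin 4 → ℝ → ℝ := fun i s => r s i - processingRate (a s) i with hgdef
  set u : Fin 4 → ℝ → ℝ := fun i s => a s i - z s i with hudef
  have hr0 : ∀ s i, 0 ≤ r s i := by
    intro s i
    simp only [hr]
    split_ifs
    exacts [σ.speed_nonneg s i, le_rfl]
  have hrσ : ∀ s i, r s i ≤ σ.speed s i := by
    intro s i
    simp only [hr]
    split_ifs
    exacts [le_rfl, σ.speed_nonneg s i]
  have hr3 : ∀ s, r s 0 + r s 1 + r s 2 ≤ 1 := fun s => by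
    linarith [hrσ s 0, hrσ s 1, hrσ s 2, (sum_le_of_schedule σ s).1]
  have hr2 : ∀ s, r s 2 + r s 3 ≤ 1 := fun s => by
    linarith [hrσ s 2, hrσ s 3, (sum_le_of_schedule σ s).2]
  have hr1 : ∀ s i, r s i ≤ 1 := by
    intro s i
    have := hr0 s
    fin_cases i
    · show r s 0 ≤ 1
      linarith [hr3 s, this 1, this 2]
    · show r s 1 ≤ 1
      linarith [hr3 s, this 0, this 2]
    · show r s 2 ≤ 1
      linarith [hr2 s, this 3]
    · show r s 3 ≤ 1
      linarith [hr2 s, this 2]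
  have hrm : ∀ i, Measurable fun s => r s i := fun i =>
    Measurable.ite (measurableSet_lt measurable_const (hz.measurable_load i))
      (σ.measurable_speed i) measurable_const
  have hpm : ∀ i, Measurable fun s => processingRate (a s) i := fun i =>
    (measurable_processingRate i).comp (measurable_pi_lambda _ hl.measurable_load)
  have hri : ∀ i b c, IntervalIntegrable (fun s => r s i) volume b c := fun i =>
    intervalIntegrable_of_abs_le (hrm i) (C := 1) fun s => by
      rw [abs_of_nonneg (hr0 s i)]; exact hr1 s i
  have hpi : ∀ i b c, IntervalIntegrable (fun s => processingRate (a s) i) volume b c := fun i =>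
    intervalIntegrable_of_abs_le (hpm i) (C := 1) fun s => by
      rw [abs_of_nonneg (processingRate_nonneg _ i)]; exact processingRate_le_one _ i
  have hgi : ∀ i b c, IntervalIntegrable (g i) volume b c := fun i b c =>
    (hri i b c).sub (hpi i b c)
  have hu : ∀ i t, 0 ≤ t → u i t = ∫ s in (0 : ℝ)..t, g i s := by
    intro i t ht
    have e : ∫ s in (0 : ℝ)..t, (if 0 < a s i then τ.speed s i else 0) =
        ∫ s in (0 : ℝ)..t, processingRate (a s) i := by
      refine intervalIntegral.integral_congr fun s hs => ?_
      rw [Set.uIcc_of_le ht] at hs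
      simp only [processingRate, hτ s hs.1]
    simp only [hudef, hgdef]
    rw [intervalIntegral.integral_sub (hri i 0 t) (hpi i 0 t), hl.balance t ht i, e,
      hz.balance t ht i]
    ring
  have hu2 : ∀ i j t, 0 ≤ t → u i t + u j t = ∫ s in (0 : ℝ)..t, (g i s + g j s) := by
    intro i j t ht
    rw [intervalIntegral.integral_add (hgi i 0 t) (hgi j 0 t), hu i t ht, hu j t ht]
  have ha0 := hl.load_nonneg
  have hz0 := hz.load_nonneg
  have hp0 : ∀ s i, 0 ≤ processingRate (a s) i := fun s i => processingRate_nonneg _ i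
  have h23 : ∀ t, 0 ≤ t → u 2 t + u 3 t ≤ 5 / 4 := by
    refine primitive_le (by norm_num) (fun b c => (hgi 2 b c).add (hgi 3 b c)) (hu2 2 3) ?_
    intro s hs hc
    rcases processingRate_two_add_three (ha0 s hs) with h | ⟨h3, h2⟩
    · simp only [hgdef]; linarith [hr2 s]
    · simp only [hudef] at hc; linarith [hz0 s hs 2, hz0 s hs 3]
  have h2 : ∀ t, 0 ≤ t → u 2 t ≤ 5 / 4 := by
    refine primitive_le (by norm_num) (hgi 2) (hu 2) ?_
    intro s hs hc
    have := processingRate_two (x := a s) (by simp only [hudef] at hc; linarith [hz0 s hs 2])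
    simp only [hgdef]; linarith [hr1 s 2]
  -- If u₃ > 5/4, then u₂ < 0 by `h23`, so a₂ < B ≤ 5/4 and machine 2 has no priority.
  have h3 : ∀ t, 0 ≤ t → u 3 t ≤ 5 / 4 := by
    refine primitive_le (by norm_num) (hgi 3) (hu 3) ?_
    intro s hs hc
    have h := h23 s hs
    simp only [hudef] at hc h
    have := processingRate_three (x := a s) (by linarith [hz0 s hs 3])
      (by linarith [hzB s hs 2])
    simp only [hgdef]; linarith [hr1 s 3]
  -- Capacity is lost only with machines 0 and 1 empty. If also a₃ > 5/4, then u₃ > 5/4 - B, so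
  -- `h23` gives u₂ < B, contradicting the excess.
  have hT : ∀ t, 0 ≤ t → u 0 t + u 1 t + u 2 t ≤ B := by
    refine primitive_le (by linarith) (fun b c => ((hgi 0 b c).add (hgi 1 b c)).add (hgi 2 b c))
      (fun t ht => ?_) ?_
    · rw [intervalIntegral.integral_add ((hgi 0 0 t).add (hgi 1 0 t)) (hgi 2 0 t),
        ← hu2 0 1 t ht, hu 2 t ht]
    intro s hs hc
    rcases processingRate_triangle (ha0 s hs) with h | ⟨h0, h1, h | h⟩
    · simp only [hgdef]; linarith [hr3 s]
    · have h' := h23 s hs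
      simp only [hudef] at hc h'
      linarith [hz0 s hs 0, hz0 s hs 1, hzB s hs 3]
    · simp only [hudef] at hc
      linarith [hz0 s hs 0, hz0 s hs 1, hz0 s hs 2]
  have h01 : ∀ t, 0 ≤ t → u 0 t + u 1 t ≤ B := by
    refine primitive_le (by linarith) (fun b c => (hgi 0 b c).add (hgi 1 b c)) (hu2 0 1) ?_
    intro s hs hc
    have h' := hT s hs
    simp only [hudef] at hc h'
    have := processingRate_zero_add_one (ha0 s hs)
      (by linarith [hz0 s hs 0, hz0 s hs 1]) (by linarith [hzB s hs 2])
    simp only [hgdef]; linarith [hr3 s, hr0 s 2]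
  have hpair : ∀ i j : Fin 4, (i = 0 ∧ j = 1 ∨ i = 1 ∧ j = 0) → ∀ t, 0 ≤ t →
      u i t ≤ 3 * B - 7 / 4 := by
    intro i j hij
    have hT' : ∀ t, 0 ≤ t → u i t + u j t + u 2 t ≤ B := by
      intro t ht
      have := hT t ht
      rcases hij with ⟨rfl, rfl⟩ | ⟨rfl, rfl⟩ <;> linarith
    have hij' : ∀ t, 0 ≤ t → u i t + u j t ≤ B := by
      intro t ht
      have := h01 t ht
      rcases hij with ⟨rfl, rfl⟩ | ⟨rfl, rfl⟩ <;> linarith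
    have hsum : ∀ y : Fin 4 → ℝ, y 0 + y 1 = y i + y j := by
      intro y
      rcases hij with ⟨rfl, rfl⟩ | ⟨rfl, rfl⟩ <;> ring
    have hri2 : ∀ s, r s i + r s 2 ≤ 1 := by
      intro s
      rcases hij with ⟨rfl, rfl⟩ | ⟨rfl, rfl⟩ <;> linarith [hr3 s, hr0 s 0, hr0 s 1]
    -- An excess forces uⱼ < 1/2 - B by `hT'`, hence aⱼ < 1/2. If `i` does not lead, then aᵢ < 1/2
    -- too, which excludes a₀ + a₁ > 1. If a₃ > 5/4, then u₂ < B, so uᵢ + u₂ < B + 1/2 ≤ 2B - 1/2.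
    have hi2 : ∀ t, 0 ≤ t → u i t + u 2 t ≤ 2 * B - 1 / 2 := by
      refine primitive_le (by linarith) (fun b c => (hgi i b c).add (hgi 2 b c)) (hu2 i 2) ?_
      intro s hs hc
      rcases processingRate_add_two hij (ha0 s hs) with h | ⟨hle, h⟩
      · simp only [hgdef]; linarith [hri2 s]
      · exfalso
        have h1 := hT' s hs
        have h2 := h23 s hs
        simp only [hudef] at hc h1 h2
        have hj : a s j < 1 / 2 := by linarith [hzB s hs j]
        rcases h with h | h | h
        · linarith [hz0 s hs i, hzB s hs 3]
        · rw [hsum] at h; linarith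
        · linarith [hz0 s hs i, hz0 s hs 2]
    -- An excess gives a₂ < 5/4 by `hi2`, aⱼ < 7/4 - B ≤ 3/4 by `hij'`, and aᵢ > 5/4: Greedy is
    -- active and serves `i` at full speed.
    refine primitive_le (by linarith) (hgi i) (hu i) ?_
    intro s hs hc
    have h1 := hi2 s hs
    have h2 := hij' s hs
    simp only [hudef] at hc h1 h2
    have hai : 5 / 4 < a s i := by linarith [hz0 s hs i]
    have := processingRate_of_greater hij (ha0 s hs) (by linarith [hzB s hs j, hz0 s hs i])
      (Or.inr (Or.inl (by rw [hsum]; linarith [ha0 s hs j]))) (by linarith [hzB s hs 2])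
    simp only [hgdef]; linarith [hr1 s i]
  intro t ht i
  have hi : u i t ≤ 3 * B - 7 / 4 := by
    fin_cases i
    · exact hpair 0 1 (by simp) t ht
    · exact hpair 1 0 (by simp) t ht
    · exact (h2 t ht).trans (by linarith)
    · exact (h3 t ht).trans (by linarith)
  simp only [hudef] at hi
  linarith [hzB t ht i]

/-- The infimum need not be attained, so only near-optimal schedules are available. -/
lemma exists_schedule_of_optBuffer_eq_one (h : optBuffer K3e I = 1) {ε : ℝ} (hε : 0 < ε) :
    ∃ B, 1 ≤ B ∧ B < 1 + ε ∧ ∃ (σ : Schedule K3e) (z : ℝ → Fin 4 → ℝ), IsLoad I σ z ∧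
      ∀ t, 0 ≤ t → ∀ i, z t i ≤ B := by
  unfold optBuffer at h
  set S := {B : ℝ | ∃ (σ : Schedule K3e) (z : ℝ → Fin 4 → ℝ), IsLoad I σ z ∧
    ∀ t, 0 ≤ t → ∀ i, z t i ≤ B}
  -- The real infimum of the empty set is 0 by convention, which the value 1 rules out.
  have hne : S.Nonempty := by
    by_contra hS
    rw [Set.not_nonempty_iff_eq_empty.1 hS, Real.sInf_empty] at h
    exact zero_ne_one h
  have hbdd : BddBelow S := ⟨0, by
    rintro B ⟨σ, z, hz, hB⟩
    exact (hz.load_nonneg 0 le_rfl 0).trans (hB 0 le_rfl 0)⟩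
  obtain ⟨B, hBS, hB⟩ := exists_lt_of_csInf_lt hne (b := 1 + ε) (by rw [h]; linarith)
  exact ⟨B, h ▸ csInf_le hbdd hBS, hB, hBS⟩

lemma load_le_of_optBuffer_eq_one (h : optBuffer K3e I = 1)
    (ha : IsRun K3e prioGreedyOriginal I a) (t : ℝ) (ht : 0 ≤ t) (i : Fin 4) :
    a t i ≤ 9 / 4 := by
  refine le_of_forall_pos_le_add fun ε hε => ?_
  obtain ⟨B, h1, hB, σ, z, hz, hzB⟩ :=
    -- The slack is multiplied by 4 in 4B - 7/4, and B ≤ 5/4 is required.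
    exists_schedule_of_optBuffer_eq_one h (ε := min (ε / 4) (1 / 4)) (by positivity)
  have := min_le_left (ε / 4) (1 / 4)
  have := min_le_right (ε / 4) (1 / 4)
  have := load_le_of_schedule ha hz hzB h1 (by linarith) t ht i
  linarith

end Invariants

/-! ### Existence of a run -/

section Existence

/-- The loads `a` start empty and, at the times in `s`, are what has arrived according to `A` minus
what the algorithm has processed. -/
structure SolvesOn (s : Set ℝ) (A a : ℝ → Fin 4 → ℝ) : Prop where
  measurable_load : ∀ i, Measurable fun t => a t i
  load_nonneg : ∀ t ∈ s, ∀ i, 0 ≤ a t i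
  balance : ∀ t ∈ s, ∀ i, a t i = A t i - ∫ r in (0 : ℝ)..t, processingRate (a r) i

lemma intervalIntegrable_processingRate {a : ℝ → Fin 4 → ℝ} (ha : ∀ i, Measurable fun t => a t i)
    (i : Fin 4) (b c : ℝ) : IntervalIntegrable (fun s => processingRate (a s) i) volume b c :=
  intervalIntegrable_of_abs_le ((measurable_processingRate i).comp (measurable_pi_lambda _ ha))
    (C := 1) (fun s => by
      rw [Function.comp_apply, abs_of_nonneg (processingRate_nonneg _ i)]; exact processingRate_le_one _ i) b c

/-- A solution up to time `τ` can be continued by a solution started from the state at `τ`. -/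
lemma SolvesOn.glue {A a y : ℝ → Fin 4 → ℝ} {x : Fin 4 → ℝ} {τ : ℝ} (hτ : 0 ≤ τ)
    (ha : SolvesOn (Set.Ico 0 τ) A a) (hy : SolvesOn (Set.Ici 0) (fun _ => x) y)
    (hx : ∀ i, x i = A τ i - ∫ r in (0 : ℝ)..τ, processingRate (a r) i)
    (hA : ∀ t, τ ≤ t → A t = A τ) : ∃ b, SolvesOn (Set.Ici 0) A b := by
  set b : ℝ → Fin 4 → ℝ := fun t => if t < τ then a t else y (t - τ) with hb
  have hbm : ∀ i, Measurable fun t => b t i := by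
    intro i
    have e : (fun t => b t i) = fun t => if t < τ then a t i else y (t - τ) i := by
      funext t
      simp only [hb]
      split_ifs <;> rfl
    rw [e]
    exact Measurable.ite measurableSet_Iio (ha.measurable_load i)
      ((hy.measurable_load i).comp (measurable_id.sub_const τ))
  have hbefore : ∀ t, t ≤ τ → 0 ≤ t → ∀ i, ∫ r in (0 : ℝ)..t, processingRate (b r) i =
      ∫ r in (0 : ℝ)..t, processingRate (a r) i := by
    intro t ht ht0 i
    refine intervalIntegral.integral_congr_Ioo_of_le ht0 fun r hr => ?_
    simp only [hb, if_pos (hr.2.trans_le ht)]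
  refine ⟨b, hbm, ?_, ?_⟩
  · intro t ht i
    simp only [hb]
    split_ifs with h
    · exact ha.load_nonneg t ⟨ht, h⟩ i
    · exact hy.load_nonneg _ (sub_nonneg.2 (not_lt.1 h)) i
  · intro t ht i
    rcases lt_or_ge t τ with h | h
    · rw [hbefore t h.le ht i]
      simp only [hb, if_pos h]
      exact ha.balance t ⟨ht, h⟩ i
    · have hi := intervalIntegrable_processingRate hbm i
      rw [← intervalIntegral.integral_add_adjacent_intervals (hi 0 τ) (hi τ t),
        hbefore τ le_rfl hτ i, hA t h]
      have e : ∫ r in τ..t, processingRate (b r) i =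
          ∫ r in (0 : ℝ)..(t - τ), processingRate (y r) i := by
        rw [← sub_self τ, ← intervalIntegral.integral_comp_sub_right
          (fun r => processingRate (y r) i)]
        refine intervalIntegral.integral_congr fun r hr => ?_
        rw [Set.uIcc_of_le h] at hr
        simp only [hb, if_neg (not_lt.2 hr.1)]
      have hbal := hy.balance (t - τ) (sub_nonneg.2 h) i
      have hbt : b t = y (t - τ) := by simp only [hb, if_neg (not_lt.2 h)]
      rw [e, hbt, hbal, hx i]
      ring

/-- The affine functionals whose signs determine the decisions of the algorithm. -/
noncomputable def threshold (x : Fin 4 → ℝ) : Fin 9 → ℝ :=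
  ![x 2 - 5 / 4, x 3 - 5 / 4, x 0 + x 1 - 1, x 0, x 1, x 2, x 3, x 0 - x 1, x 1 - x 0]

/-- Strict signs also settle the equality tests: for nonnegative loads, zero means not positive, and
a tie means that neither difference is positive. -/
lemma processingRate_congr {x y : Fin 4 → ℝ} (hx : ∀ i, 0 ≤ x i) (hy : ∀ i, 0 ≤ y i)
    (h : ∀ j, 0 < threshold x j ↔ 0 < threshold y j) : processingRate x = processingRate y := by
  have h0 : x 2 > 5 / 4 ↔ y 2 > 5 / 4 := by simpa [threshold] using h 0
  have h1 : x 3 > 5 / 4 ↔ y 3 > 5 / 4 := by simpa [threshold] using h 1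
  have h2 : x 0 + x 1 > 1 ↔ y 0 + y 1 > 1 := by simpa [threshold] using h 2
  have h3 : 0 < x 0 ↔ 0 < y 0 := by simpa [threshold] using h 3
  have h4 : 0 < x 1 ↔ 0 < y 1 := by simpa [threshold] using h 4
  have h5 : 0 < x 2 ↔ 0 < y 2 := by simpa [threshold] using h 5
  have h6 : 0 < x 3 ↔ 0 < y 3 := by simpa [threshold] using h 6
  have h7 : x 1 < x 0 ↔ y 1 < y 0 := by simpa [threshold] using h 7
  have h8 : x 0 < x 1 ↔ y 0 < y 1 := by simpa [threshold] using h 8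
  have h9 : x 2 = 0 ↔ y 2 = 0 := by
    rw [← (hx 2).not_lt_iff_eq', ← (hy 2).not_lt_iff_eq', h5]
  have h10 : x 0 = x 1 ↔ y 0 = y 1 := by
    constructor <;> intro e
    · exact le_antisymm (not_lt.1 (mt h7.2 (by simp [e]))) (not_lt.1 (mt h8.2 (by simp [e])))
    · exact le_antisymm (not_lt.1 (mt h7.1 (by simp [e]))) (not_lt.1 (mt h8.1 (by simp [e])))
  have h11 : x 1 = x 0 ↔ y 1 = y 0 := by rw [eq_comm, h10, eq_comm]
  have e : prioGreedyOriginal x = prioGreedyOriginal y := by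
    simp only [prioGreedyOriginal, greedySpeed, h0, h1, h2, h7, h8, h9, h10, h11]
  funext i
  have hi : 0 < x i ↔ 0 < y i := by fin_cases i <;> assumption
  simp only [processingRate, hi, e]

lemma threshold_sub_smul (x v : Fin 4 → ℝ) (s : ℝ) (j : Fin 9) :
    threshold (x - s • v) j = threshold x j - s * (threshold x j - threshold (x - v) j) := by
  fin_cases j <;> simp [threshold] <;> ring

/-- While the algorithm processes at its current rates, a threshold that is not exceeded decreases,
or it is opposite to one that is exceeded. -/
lemma threshold_of_nonpos {x : Fin 4 → ℝ} {j : Fin 9} (hj : threshold x j ≤ 0) :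
    threshold (x - processingRate x) j ≤ threshold x j ∨
      ∃ k, 0 < threshold x k ∧ ∀ y, threshold y j = - threshold y k := by
  have h := processingRate_nonneg x
  have heq : x 0 = x 1 → processingRate x 0 = processingRate x 1 := by
    intro e
    rcases prioGreedyOriginal_cases x with ⟨e', -⟩ | ⟨e', -⟩ <;> simp [processingRate, e', e]
  fin_cases j
  · left; simpa [threshold] using h 2
  · left; simpa [threshold] using h 3
  · left; simp [threshold]; linarith [h 0, h 1]
  · left; simpa [threshold] using h 0
  · left; simpa [threshold] using h 1
  · left; simpa [threshold] using h 2
  · left; simpa [threshold] using h 3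
  -- A tie persists because equal loads are processed at equal rates; otherwise the opposite
  -- difference is positive.
  · have hj' : x 0 - x 1 ≤ 0 := hj
    rcases hj'.eq_or_lt with e | e
    · left; simp [threshold]; linarith [heq (by linarith)]
    · right; exact ⟨8, by simpa [threshold] using e, by simp [threshold]⟩
  · have hj' : x 1 - x 0 ≤ 0 := hj
    rcases hj'.eq_or_lt with e | e
    · left; simp [threshold]; linarith [heq (by linarith)]
    · right; exact ⟨7, by simpa [threshold] using e, by simp [threshold]⟩

lemma exists_threshold_eq_load (i : Fin 4) : ∃ j, ∀ x, threshold x j = x i := by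
  fin_cases i
  exacts [⟨3, fun _ => rfl⟩, ⟨4, fun _ => rfl⟩, ⟨5, fun _ => rfl⟩, ⟨6, fun _ => rfl⟩]

lemma pos_of_processingRate_ne_zero {x : Fin 4 → ℝ} {i : Fin 4} (h : processingRate x i ≠ 0) :
    0 < x i := by
  by_contra h'
  exact h (if_neg h')

/-- The algorithm keeps its rates until the first exceeded threshold is reached. -/
lemma exists_linear_phase {x : Fin 4 → ℝ} (hx : ∀ i, 0 ≤ x i) (hv : processingRate x ≠ 0) :
    ∃ τ : ℝ, 0 ≤ τ ∧ (∀ s : ℝ, 0 ≤ s → s ≤ τ → ∀ i, 0 ≤ (x - s • processingRate x) i) ∧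
      (∀ s : ℝ, 0 ≤ s → s < τ → processingRate (x - s • processingRate x) = processingRate x) ∧
      (∀ j, 0 < threshold (x - τ • processingRate x) j → 0 < threshold x j) ∧
      ∃ j, 0 < threshold x j ∧ ¬ 0 < threshold (x - τ • processingRate x) j := by
  set v := processingRate x with hvdef
  set m : Fin 9 → ℝ := fun j => threshold x j - threshold (x - v) j with hm
  have hlin : ∀ s j, threshold (x - s • v) j = threshold x j - s * m j :=
    fun s j => threshold_sub_smul x v s j
  -- Positive thresholds that decrease; the first to vanish ends the phase. Some load is being
  -- processed, and loads are themselves thresholds, so there is one.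
  set Q : Finset (Fin 9) := Finset.univ.filter fun j => 0 < threshold x j ∧ 0 < m j
  have hQ : Q.Nonempty := by
    obtain ⟨i, hi⟩ := Function.ne_iff.1 hv
    obtain ⟨j, hj⟩ := exists_threshold_eq_load i
    refine ⟨j, Finset.mem_filter.2 ⟨Finset.mem_univ _, ?_, ?_⟩⟩
    · rw [hj]; exact pos_of_processingRate_ne_zero hi
    · simp only [hm, hj]
      have : 0 < v i := (processingRate_nonneg x i).lt_of_ne' hi
      simpa using this
  obtain ⟨k, hkQ, hk⟩ := Q.exists_min_image (fun j => threshold x j / m j) hQ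
  obtain ⟨-, hk1, hk2⟩ := Finset.mem_filter.1 hkQ
  set τ := threshold x k / m k with hτ
  have hτ0 : 0 < τ := div_pos hk1 hk2
  have hle : ∀ j, 0 < threshold x j → ∀ s, 0 ≤ s → s ≤ τ → 0 ≤ threshold (x - s • v) j := by
    intro j hj s hs hsτ
    rw [hlin]
    rcases le_or_gt (m j) 0 with h | h
    · nlinarith
    · have := hk j (Finset.mem_filter.2 ⟨Finset.mem_univ _, hj, h⟩)
      have := (le_div_iff₀ h).1 (hsτ.trans this)
      linarith
  have hlt : ∀ j, 0 < threshold x j → ∀ s, 0 ≤ s → s < τ → 0 < threshold (x - s • v) j := by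
    intro j hj s hs hsτ
    rw [hlin]
    rcases le_or_gt (m j) 0 with h | h
    · nlinarith
    · have := hk j (Finset.mem_filter.2 ⟨Finset.mem_univ _, hj, h⟩)
      have := (lt_div_iff₀ h).1 (hsτ.trans_le this)
      linarith
  have hnonpos : ∀ j, ¬ 0 < threshold x j → ∀ s, 0 ≤ s → s ≤ τ →
      ¬ 0 < threshold (x - s • v) j := by
    intro j hj s hs hsτ
    rcases threshold_of_nonpos (not_lt.1 hj) with h | ⟨l, hl, h⟩
    · have : 0 ≤ m j := sub_nonneg.2 h
      rw [hlin]
      nlinarith [mul_nonneg hs this]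
    · rw [h]
      linarith [hle l hl s hs hsτ]
  have hnn : ∀ s, 0 ≤ s → s ≤ τ → ∀ i, 0 ≤ (x - s • v) i := by
    intro s hs hsτ i
    by_cases hi : v i = 0
    · simpa [hi] using hx i
    · obtain ⟨j, hj⟩ := exists_threshold_eq_load i
      rw [← hj (x - s • v)]
      exact hle j (by rw [hj]; exact pos_of_processingRate_ne_zero hi) s hs hsτ
  refine ⟨τ, hτ0.le, hnn, fun s hs hsτ => ?_, fun j hj => ?_, k, hk1, ?_⟩
  · refine processingRate_congr (hnn s hs hsτ.le) hx fun j => ⟨fun h => ?_, fun h => ?_⟩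
    · by_contra hj
      exact hnonpos j hj s hs hsτ.le h
    · exact hlt j h s hs hsτ
  · by_contra hj'
    exact hnonpos j hj' τ hτ0.le le_rfl hj
  · rw [hlin, hτ, div_mul_cancel₀ _ hk2.ne']
    simp

/-- From every state the algorithm has a run without further arrivals. -/
lemma exists_solvesOn_const {x : Fin 4 → ℝ} (hx : ∀ i, 0 ≤ x i) :
    ∃ y, SolvesOn (Set.Ici 0) (fun _ => x) y := by
  induction hn : (Finset.univ.filter fun j => 0 < threshold x j).card using Nat.strong_induction_on
    generalizing x with
  | _ n ih =>
    by_cases hv : processingRate x = 0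
    · exact ⟨fun _ => x, fun i => measurable_const, fun _ _ => hx, fun t _ i => by simp [hv]⟩
    obtain ⟨τ, hτ, hnn, hrate, hsub, k, hk, hk'⟩ := exists_linear_phase hx hv
    -- At the end of the phase strictly fewer thresholds are positive.
    obtain ⟨y, hy⟩ := ih _ (by
      rw [← hn]
      refine Finset.card_lt_card ⟨fun j hj => ?_, fun h => ?_⟩
      · simp only [Finset.mem_filter, Finset.mem_univ, true_and] at hj ⊢
        exact hsub j hj
      · exact hk' (Finset.mem_filter.1 (h (Finset.mem_filter.2 ⟨Finset.mem_univ _, hk⟩))).2)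
      (hnn τ hτ le_rfl) rfl
    have hint : ∀ t : ℝ, 0 ≤ t → t ≤ τ → ∀ i,
        ∫ r in (0 : ℝ)..t, processingRate (x - r • processingRate x) i =
          t * processingRate x i := by
      intro t ht htτ i
      rw [intervalIntegral.integral_congr_Ioo_of_le (g := fun _ => processingRate x i) ht
        fun r hr => by simp only [hrate r hr.1.le (hr.2.trans_le htτ)]]
      simp
    refine SolvesOn.glue (a := fun s => x - s • processingRate x) hτ ⟨fun i => ?_, ?_, ?_⟩ hy ?_
      fun _ _ => rfl
    · exact measurable_const.sub (measurable_id.mul_const _)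
    · exact fun t ht i => hnn t ht.1 ht.2.le i
    · intro t ht i
      rw [hint t ht.1 ht.2.le i]
      simp
    · intro i
      rw [hint τ hτ le_rfl i]
      simp

/-! ### Adding the jobs one at a time -/

lemma arrived_cons (j : Job (Fin 4)) (I : Input (Fin 4)) (i : Fin 4) (t : ℝ) :
    arrived (j :: I) i t = (if j.machine = i ∧ j.time ≤ t then j.size else 0) + arrived I i t := by
  simp [arrived]

lemma arrived_perm {I J : Input (Fin 4)} (h : I.Perm J) : arrived I = arrived J := by
  funext i t
  exact (h.map _).sum_eq

lemma arrived_of_le {I : Input (Fin 4)} {τ t : ℝ} (h : ∀ j ∈ I, j.time ≤ τ) (ht : τ ≤ t)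
    (i : Fin 4) : arrived I i t = arrived I i τ := by
  unfold arrived
  congr 1
  refine List.map_congr_left fun j hj => ?_
  simp [h j hj, (h j hj).trans ht]

/-- With the latest job at the head, the run for the tail is kept before that job's time and
restarted from the increased load; nothing arrives afterwards. -/
lemma exists_solvesOn_of_pairwise (I : Input (Fin 4))
    (hI : I.Pairwise fun j k => k.time ≤ j.time) :
    ∃ a, SolvesOn (Set.Ici 0) (fun t i => arrived I i t) a := by
  induction I with
  | nil =>
    obtain ⟨y, hy⟩ := exists_solvesOn_const (x := 0) fun _ => le_rfl
    exact ⟨y, hy.measurable_load, hy.load_nonneg, by simpa [arrived] using hy.balance⟩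
  | cons j I ih =>
    obtain ⟨hj, hI'⟩ := List.pairwise_cons.1 hI
    obtain ⟨a, ha⟩ := ih hI'
    have hbefore : ∀ t, t < j.time → ∀ i, arrived (j :: I) i t = arrived I i t := by
      intro t ht i
      rw [arrived_cons, if_neg fun h => ht.not_ge h.2, zero_add]
    have hat := ha.balance j.time j.time_nonneg
    obtain ⟨y, hy⟩ := exists_solvesOn_const
      (x := fun i => a j.time i + if j.machine = i then j.size else 0) (by
        intro i
        have := ha.load_nonneg j.time j.time_nonneg i
        have := j.size_nonneg
        split_ifs <;> linarith)
    refine SolvesOn.glue (a := a) j.time_nonneg ⟨ha.measurable_load,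
      fun t ht => ha.load_nonneg t ht.1, fun t ht i => ?_⟩ hy (fun i => ?_) fun t ht => ?_
    · rw [hbefore t ht.2 i]
      exact ha.balance t ht.1 i
    · rw [hat i, arrived_cons]
      simp only [le_refl, and_true]
      ring
    · funext i
      refine arrived_of_le (fun k hk => ?_) ht i
      rcases List.mem_cons.1 hk with rfl | hk
      exacts [le_rfl, hj k hk]

lemma exists_isRun (I : Input (Fin 4)) : ∃ a, IsRun K3e prioGreedyOriginal I a := by
  classical
  have hsort := List.pairwise_insertionSort (fun j k : Job (Fin 4) => k.time ≤ j.time) I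
  obtain ⟨a, ha⟩ := exists_solvesOn_of_pairwise _ hsort
  rw [arrived_perm (List.perm_insertionSort _ I)] at ha
  refine ⟨a, ⟨fun t => prioGreedyOriginal (a t), fun i => ?_, fun t i => ?_, fun t K hK => ?_⟩,
    fun t _ => rfl, ha.measurable_load, ha.load_nonneg, ha.balance⟩
  · exact (measurable_prioGreedyOriginal i).comp (measurable_pi_lambda _ ha.measurable_load)
  · exact prioGreedyOriginal_nonneg _ i
  · exact sum_prioGreedyOriginal_le_one _ K hK

end Existence

end BufferMin

theorem mainTheorem11 :
    BufferMin.IsWeaklyCompetitive BufferMin.K3e BufferMin.prioGreedyOriginal (9 / 4) := by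
  intro I hI
  refine ⟨BufferMin.exists_isRun I, fun a ha t ht i => ?_⟩
  rw [hI, mul_one]
  exact BufferMin.load_le_of_optBuffer_eq_one hI ha t ht i
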